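/- Let $X$ be the graph with vertex set $\mathbb{Z}^2$ in which two vertices $(x,y)$, $(x',y')$ are joined by an edge if and only if $|x-x'|+|y-y'|=1$. For $A\subset\mathbb{Z}^2$ let $\partial A$ be the set of vertices not in $A$ that are adjacent to a vertex of $A$. Two subsets of $\mathbb{Z}^2$ are congruent if a graph automorphism of $X$ maps one onto the other. For $\alpha,\beta\in\mathbb{N}=\{0,1,2,\dots\}$ let $$B(\alpha,\beta)=\{(x,y)\in\mathbb{Z}^2 : 0\le y-x\le\alpha,\ 0\le y+x\le\beta\},$$ $$\hat B(\alpha,\beta)=\{(x,y)\in\mathbb{Z}^2 : 0\le y-x\le\alpha,\ -1\le y+x\le\beta-1\}.$$ A box is a non-empty set congruent to some $B(\alpha,\beta)$, or to some $\hat B(\alpha,\beta)$ with $\alpha,\beta$ even. A set $A$ is efficient if it is finite and $|B|\le|A|$ for every finite $B\subset\mathbb{Z}^2$ with $|\partial B|=|\partial A|$; it is minimal if it is finite and $|\partial A|\le|\partial B|$ for every $B\subset\mathbb{Z}^2$ with $|B|=|A|$; it is saturated if $|\partial(A\cup\{v\})|>|\partial A|$ for every $v\in\mathbb{Z}^2\setminus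 A$. **Theorem D.** A non-empty subset $A$ of $\mathbb{Z}^2$ is efficient if and only if it is congruent to $B(n,n)$, to $B(n,n+1)$, or to $B(2n,2n+2)$ for some $n\in\mathbb{N}$ (the sets $B(2n,2n+2)$ are the sets $B(m-1,m+1)$ with $m$ odd). Moreover, every non-empty efficient set is minimal, saturated and a box. -/

import Mathlib

namespace LatticeIso

/-- The graph with vertex set `ℤ²` in which two vertices are adjacent if and only if their
`ℓ₁`-distance is one. -/
def latticeGraph : SimpleGraph (ℤ × ℤ) where
  Adj p q := |p.1 - q.1| + |p.2 - q.2| = 1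
  symm := ⟨fun p q h => by rwa [abs_sub_comm q.1, abs_sub_comm q.2]⟩
  loopless := ⟨fun p h => by simp at h⟩

/-- The vertex boundary of a set `A` of vertices of a graph `G`: the vertices outside `A` that are
adjacent to a vertex of `A`. -/
def vertexBoundary {V : Type*} (G : SimpleGraph V) (A : Set V) : Set V :=
  {u | u ∉ A ∧ ∃ v ∈ A, G.Adj u v}

/-- The vertex boundary in the integer lattice. -/
abbrev bdry (A : Set (ℤ × ℤ)) : Set (ℤ × ℤ) := vertexBoundary latticeGraph A

/-- Two sets of lattice points are congruent if a graph automorphism maps one onto the other. -/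
def Congruent (A B : Set (ℤ × ℤ)) : Prop :=
  ∃ φ : latticeGraph ≃g latticeGraph, φ '' A = B

/-- A finite set is minimal if its vertex boundary has the smallest cardinality among all sets
with the same number of vertices. -/
def IsMinimalSet (A : Set (ℤ × ℤ)) : Prop :=
  A.Finite ∧ ∀ B : Set (ℤ × ℤ), B.encard = A.encard → (bdry A).encard ≤ (bdry B).encard

/-- A finite set is efficient if it has the largest cardinality among all finite sets whose vertex
boundary has the same cardinality. -/
def IsEfficient (A : Set (ℤ × ℤ)) : Prop :=
  A.Finite ∧ ∀ B : Set (ℤ × ℤ), B.Finite → (bdry B).encard = (bdry A).encard →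
    B.encard ≤ A.encard

/-- A set is saturated if adding any further vertex strictly increases the size of its vertex
boundary. -/
def IsSaturated (A : Set (ℤ × ℤ)) : Prop :=
  ∀ v ∉ A, (bdry A).encard < (bdry (A ∪ {v})).encard

/-- The standard box `B(α, β)`. -/
def stdBox (α β : ℕ) : Set (ℤ × ℤ) :=
  {p | 0 ≤ p.2 - p.1 ∧ p.2 - p.1 ≤ α ∧ 0 ≤ p.2 + p.1 ∧ p.2 + p.1 ≤ β}

/-- The shifted standard box, used for even `α` and `β`. -/
def stdBoxHat (α β : ℕ) : Set (ℤ × ℤ) :=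
  {p | 0 ≤ p.2 - p.1 ∧ p.2 - p.1 ≤ α ∧ -1 ≤ p.2 + p.1 ∧ p.2 + p.1 ≤ (β : ℤ) - 1}

/-- A box is a non-empty set that is congruent to a standard box or to a shifted standard box with
even parameters. -/
def IsBox (A : Set (ℤ × ℤ)) : Prop :=
  A.Nonempty ∧ ((∃ α β : ℕ, Congruent A (stdBox α β)) ∨
    ∃ α β : ℕ, Even α ∧ Even β ∧ Congruent A (stdBoxHat α β))

end LatticeIso

namespace LatticeIso

open Finset

/-! In the coordinates (y - x, y + x) adjacency becomes diagonal adjacency between pairs of equal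
parity. A finite set A splits into colour classes P, Q by the parity of the first coordinate, and
neighbours of one class lie in the other colour, so the boundary has n = |N(P) \ Q| + |N(Q) \ P|
points. A diagonal step is a horizontal step followed by a vertical one, whence |N(T)| ≥ |T| +
columns + rows + 1 (`card_diagNbhd_ge`). Together with |T| ≤ columns · rows this gives 8|A| ≤ (n -
2)² + 4 (`pair_isoperimetric`).

Call A nearly extremal if 8|A| ≥ (n - 2)² - 1. The two bounds leave six consecutive integers for
8|A|, so a non-empty nearly extremal set has the largest size its boundary allows; efficiency,
saturation and minimality follow by arithmetic. Conversely, B(k, k) and B(k, k + 1) attain the lower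
bound and realise every n ≥ 4 except 5, so non-empty efficient sets are nearly extremal.

If both classes are non-empty, near extremality turns the counting inequalities into equalities.
Then the projections of P ∪ Q are intervals, and A lies in a rotated w × h rectangle with w + h ≤ n
- 2; a lone class has at most two points and is handled directly. Comparing sizes, A is the whole
rectangle. Its size makes (w - h)² ≤ 1 + 4ε, with ε ∈ {-1, 0, 1} a parity correction, which leaves
only the listed boxes. -/

/-- The integers at distance one from an element of `C`. -/
def stepNbhd (C : Finset ℤ) : Finset ℤ := C.image (· + 1) ∪ C.image (· - 1)

/-- The points at horizontal distance one from a point of `T`. -/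
def horizNbhd (T : Finset (ℤ × ℤ)) : Finset (ℤ × ℤ) :=
  T.image (fun p => (p.1 + 1, p.2)) ∪ T.image (fun p => (p.1 - 1, p.2))

/-- The points at vertical distance one from a point of `T`. -/
def vertNbhd (T : Finset (ℤ × ℤ)) : Finset (ℤ × ℤ) :=
  T.image (fun p => (p.1, p.2 + 1)) ∪ T.image (fun p => (p.1, p.2 - 1))

/-- The points diagonally adjacent to a point of `T`. -/
def diagNbhd (T : Finset (ℤ × ℤ)) : Finset (ℤ × ℤ) := vertNbhd (horizNbhd T)

lemma mem_stepNbhd {C : Finset ℤ} {x : ℤ} : x ∈ stepNbhd C ↔ x - 1 ∈ C ∨ x + 1 ∈ C := by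
  simp only [stepNbhd, mem_union, mem_image]
  refine or_congr ⟨?_, fun h => ⟨_, h, by ring⟩⟩ ⟨?_, fun h => ⟨_, h, by ring⟩⟩ <;>
    rintro ⟨a, ha, rfl⟩ <;> simpa using ha

lemma mem_horizNbhd {T : Finset (ℤ × ℤ)} {x y : ℤ} :
    (x, y) ∈ horizNbhd T ↔ (x - 1, y) ∈ T ∨ (x + 1, y) ∈ T := by
  simp only [horizNbhd, mem_union, mem_image]
  refine or_congr ⟨?_, fun h => ⟨_, h, by simp⟩⟩ ⟨?_, fun h => ⟨_, h, by simp⟩⟩ <;>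
    rintro ⟨a, ha, h⟩ <;> obtain ⟨rfl, rfl⟩ := Prod.mk.inj h <;> simpa using ha

lemma mem_vertNbhd {T : Finset (ℤ × ℤ)} {x y : ℤ} :
    (x, y) ∈ vertNbhd T ↔ (x, y - 1) ∈ T ∨ (x, y + 1) ∈ T := by
  simp only [vertNbhd, mem_union, mem_image]
  refine or_congr ⟨?_, fun h => ⟨_, h, by simp⟩⟩ ⟨?_, fun h => ⟨_, h, by simp⟩⟩ <;>
    rintro ⟨a, ha, h⟩ <;> obtain ⟨rfl, rfl⟩ := Prod.mk.inj h <;> simpa using ha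

lemma mem_diagNbhd {T : Finset (ℤ × ℤ)} {x y : ℤ} :
    (x, y) ∈ diagNbhd T ↔ ((x - 1, y - 1) ∈ T ∨ (x + 1, y - 1) ∈ T) ∨
      (x - 1, y + 1) ∈ T ∨ (x + 1, y + 1) ∈ T := by
  simp only [diagNbhd, mem_vertNbhd, mem_horizNbhd]

lemma diagNbhd_eq_horizNbhd_vertNbhd (T : Finset (ℤ × ℤ)) :
    diagNbhd T = horizNbhd (vertNbhd T) := by
  ext ⟨x, y⟩
  simp only [diagNbhd, mem_vertNbhd, mem_horizNbhd]
  tauto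

/-! ### Growth of neighbourhoods and its equality case -/

lemma card_lt_card_stepNbhd {C : Finset ℤ} (hC : C.Nonempty) : #C + 1 ≤ #(stepNbhd C) := by
  have hnot : C.min' hC - 1 ∉ C.image (· + 1) := by
    rw [mem_image]
    rintro ⟨a, ha, h⟩
    have := C.min'_le a ha
    omega
  rw [← card_image_of_injective C (add_left_injective (1 : ℤ)), ← card_insert_of_notMem hnot]
  refine card_le_card (insert_subset ?_ subset_union_left)
  exact mem_stepNbhd.2 (Or.inr (by simpa using C.min'_mem hC))

/-- The right shift of T has #T points and, in each row of T, misses the left neighbour of the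
leftmost point. -/
lemma card_add_card_image_snd_le (T : Finset (ℤ × ℤ)) :
    #T + #(T.image Prod.snd) ≤ #(horizNbhd T) := by
  set S := T.image (fun p : ℤ × ℤ => (p.1 + 1, p.2)) with hS
  have hST : #S = #T := card_image_of_injective _ fun p q h => by
    have := Prod.mk.inj h
    exact Prod.ext (by simpa using this.1) this.2
  have hsub : S ⊆ horizNbhd T := subset_union_left
  have hrow : T.image Prod.snd ⊆ (horizNbhd T \ S).image Prod.snd := by
    intro y hy
    obtain ⟨p, hp, rfl⟩ := mem_image.1 hy
    have hne : ((T.filter (fun q => q.2 = p.2)).image Prod.fst).Nonempty :=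
      ⟨p.1, mem_image.2 ⟨p, by simp [hp], rfl⟩⟩
    set F := (T.filter (fun q => q.2 = p.2)).image Prod.fst
    have hmem : (F.min' hne, p.2) ∈ T := by
      obtain ⟨q, hq, hq'⟩ := mem_image.1 (F.min'_mem hne)
      rw [mem_filter] at hq
      rw [← hq', ← hq.2]
      exact hq.1
    refine mem_image.2 ⟨(F.min' hne - 1, p.2), mem_sdiff.2 ⟨?_, ?_⟩, rfl⟩
    · exact mem_horizNbhd.2 (Or.inr (by simpa using hmem))
    · rw [hS, mem_image]
      rintro ⟨q, hq, h⟩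
      obtain ⟨h1, h2⟩ := Prod.mk.inj h
      have := F.min'_le q.1 (mem_image.2 ⟨q, by simp [hq, h2], rfl⟩)
      omega
  have h1 := card_le_card hrow
  have h2 : #((horizNbhd T \ S).image Prod.snd) ≤ #(horizNbhd T \ S) := card_image_le
  have h3 := card_sdiff_add_card_eq_card hsub
  omega

lemma card_add_card_image_fst_le (T : Finset (ℤ × ℤ)) :
    #T + #(T.image Prod.fst) ≤ #(vertNbhd T) := by
  have h := card_add_card_image_snd_le (T.image Prod.swap)
  have h1 : horizNbhd (T.image Prod.swap) = (vertNbhd T).image Prod.swap := by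
    simp [horizNbhd, vertNbhd, image_union, image_image, Function.comp_def]
  rw [h1, card_image_of_injective _ Prod.swap_injective,
    card_image_of_injective _ Prod.swap_injective, image_image] at h
  exact h

lemma image_fst_horizNbhd (T : Finset (ℤ × ℤ)) :
    (horizNbhd T).image Prod.fst = stepNbhd (T.image Prod.fst) := by
  simp [horizNbhd, stepNbhd, image_union, image_image, Function.comp_def]

lemma image_snd_vertNbhd (T : Finset (ℤ × ℤ)) :
    (vertNbhd T).image Prod.snd = stepNbhd (T.image Prod.snd) := by
  simp [vertNbhd, stepNbhd, image_union, image_image, Function.comp_def]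

lemma image_fst_vertNbhd (T : Finset (ℤ × ℤ)) :
    (vertNbhd T).image Prod.fst = T.image Prod.fst := by
  simp [vertNbhd, image_union, image_image, Function.comp_def]

lemma image_snd_horizNbhd (T : Finset (ℤ × ℤ)) :
    (horizNbhd T).image Prod.snd = T.image Prod.snd := by
  simp [horizNbhd, image_union, image_image, Function.comp_def]

lemma image_fst_diagNbhd (T : Finset (ℤ × ℤ)) :
    (diagNbhd T).image Prod.fst = stepNbhd (T.image Prod.fst) := by
  rw [diagNbhd, image_fst_vertNbhd, image_fst_horizNbhd]

lemma image_snd_diagNbhd (T : Finset (ℤ × ℤ)) :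
    (diagNbhd T).image Prod.snd = stepNbhd (T.image Prod.snd) := by
  rw [diagNbhd, image_snd_vertNbhd, image_snd_horizNbhd]

/-- The vertical step acts on the horizontally widened set, so it gains one point per column of that
set. Keeping the step neighbourhood, rather than columns + 1, lets equality later bound the gaps in
the projection. -/
lemma card_diagNbhd_ge_fst (T : Finset (ℤ × ℤ)) :
    #T + #(T.image Prod.snd) + #(stepNbhd (T.image Prod.fst)) ≤ #(diagNbhd T) := by
  have h1 := card_add_card_image_snd_le T
  have h2 := card_add_card_image_fst_le (horizNbhd T)
  rw [image_fst_horizNbhd] at h2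
  rw [diagNbhd]
  omega

lemma card_diagNbhd_ge_snd (T : Finset (ℤ × ℤ)) :
    #T + #(T.image Prod.fst) + #(stepNbhd (T.image Prod.snd)) ≤ #(diagNbhd T) := by
  have h1 := card_add_card_image_fst_le T
  have h2 := card_add_card_image_snd_le (vertNbhd T)
  rw [image_snd_vertNbhd] at h2
  rw [diagNbhd_eq_horizNbhd_vertNbhd]
  omega

lemma card_diagNbhd_ge {T : Finset (ℤ × ℤ)} (hT : T.Nonempty) :
    #T + #(T.image Prod.fst) + #(T.image Prod.snd) + 1 ≤ #(diagNbhd T) := by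
  have h1 := card_diagNbhd_ge_fst T
  have h2 := card_lt_card_stepNbhd (hT.image Prod.fst)
  omega

/-- A finite set of integers with at most two integers next to it is an interval. -/
lemma eq_Ico_of_card_stepNbhd_sdiff_le {C : Finset ℤ} (hC : C.Nonempty)
    (h : #(stepNbhd C \ C) ≤ 2) : ∃ i : ℤ, C = Ico i (i + #C) := by
  have key : ∀ g, C.min' hC ≤ g → g ≤ C.max' hC → g ∈ C := by
    intro g h1 h2
    by_contra hg
    have hne : (C.filter (· < g)).Nonempty :=
      ⟨C.min' hC, mem_filter.2 ⟨C.min'_mem hC, lt_of_le_of_ne h1 fun e => hg (e ▸ C.min'_mem hC)⟩⟩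
    -- With z the last element before a gap g, the point z + 1 is a third outside neighbour besides
    -- those at the two ends.
    set z := (C.filter (· < g)).max' hne with hz
    have hzm := mem_filter.1 ((C.filter (· < g)).max'_mem hne)
    rw [← hz] at hzm
    have hz1 : z + 1 ∉ C := by
      intro hmem
      by_cases hlt : z + 1 < g
      · have := (C.filter (· < g)).le_max' _ (mem_filter.2 ⟨hmem, hlt⟩)
        omega
      · have : z + 1 = g := by omega
        exact hg (this ▸ hmem)
    have hmin := C.min'_le z hzm.1
    have hlo : C.min' hC - 1 ∉ C := fun hm => by have := C.min'_le _ hm; omega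
    have hhi : C.max' hC + 1 ∉ C := fun hm => by have := C.le_max' _ hm; omega
    have hsub : ({C.min' hC - 1, z + 1, C.max' hC + 1} : Finset ℤ) ⊆ stepNbhd C \ C := by
      intro x hx
      simp only [mem_insert, mem_singleton] at hx
      rw [mem_sdiff, mem_stepNbhd]
      rcases hx with rfl | rfl | rfl
      · exact ⟨Or.inr (by simpa using C.min'_mem hC), hlo⟩
      · exact ⟨Or.inl (by simpa using hzm.1), hz1⟩
      · exact ⟨Or.inl (by simpa using C.max'_mem hC), hhi⟩
    have hcard : #({C.min' hC - 1, z + 1, C.max' hC + 1} : Finset ℤ) = 3 :=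
      card_eq_three.2 ⟨_, _, _, by omega, by omega, by omega, rfl⟩
    have := card_le_card hsub
    omega
  have hIcc : C = Icc (C.min' hC) (C.max' hC) := by
    ext g
    rw [mem_Icc]
    exact ⟨fun hg => ⟨C.min'_le g hg, C.le_max' g hg⟩, fun hg => key g hg.1 hg.2⟩
  refine ⟨C.min' hC, ?_⟩
  have hle := C.min'_le _ (C.max'_mem hC)
  have hcard : (#C : ℤ) = C.max' hC + 1 - C.min' hC := by
    conv_lhs => rw [hIcc]
    rw [Int.card_Icc, Int.toNat_of_nonneg (by omega)]
  rw [hcard]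
  conv_lhs => rw [hIcc]
  ext g
  simp only [mem_Icc, mem_Ico]
  omega

/-- Outside neighbours of C ∪ D lie in N(C) \ D or N(D) \ C, of sizes at most #C + 1 - #D and #D + 1
- #C; the sum is at most 2. -/
lemma union_eq_Ico_of_subset_stepNbhd {C D : Finset ℤ} (hC : C.Nonempty)
    (hCD : C ⊆ stepNbhd D) (hDC : D ⊆ stepNbhd C) (h1 : #(stepNbhd C) ≤ #C + 1)
    (h2 : #(stepNbhd D) ≤ #D + 1) : ∃ i : ℤ, C ∪ D = Ico i (i + #(C ∪ D)) := by
  refine eq_Ico_of_card_stepNbhd_sdiff_le (hC.mono subset_union_left) ?_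
  have hsub : stepNbhd (C ∪ D) \ (C ∪ D) ⊆ (stepNbhd C \ D) ∪ (stepNbhd D \ C) := by
    intro x
    simp only [mem_sdiff, mem_union, mem_stepNbhd]
    tauto
  have h3 := card_le_card hsub
  have h4 := card_union_le (stepNbhd C \ D) (stepNbhd D \ C)
  have h5 := card_sdiff_add_card_eq_card hDC
  have h6 := card_sdiff_add_card_eq_card hCD
  omega

/-! ### Isoperimetry for a pair of sets -/

/-- Since 2p² + 2q² = (p + q)² + (p - q)², only |p - q| > 2 needs care. For large p, the balance
condition gives 4a ≤ (q + 2)²; for large q, b ≤ a ≤ p²/4. -/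
lemma eight_mul_add_le_of_sub_le {a b p q : ℤ} (hab : b ≤ a) (hp : 4 * a ≤ p ^ 2)
    (hq : 4 * b ≤ q ^ 2) (hp0 : 0 ≤ p) (hq0 : 0 ≤ q) (hd : a - b ≤ q + 1) :
    8 * (a + b) ≤ (p + q) ^ 2 + 4 := by
  rcases le_or_gt p (q + 2) with h | h
  · rcases le_or_gt q p with h' | h'
    · nlinarith [mul_nonneg (sub_nonneg.2 h) (sub_nonneg.2 h')]
    · nlinarith
  · nlinarith

/-- The unbalanced case, strictly below the near-extremal range. With d = a - b, write a + b as 2a -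
d and bound a by p if p ≤ d; otherwise write it as 2b + d and use q ≤ d - 2. -/
lemma lt_of_add_two_le_sub {a b p q : ℤ} (hp : 4 * a ≤ p ^ 2) (hq : 4 * b ≤ q ^ 2)
    (hp0 : 0 ≤ p) (hq2 : 2 ≤ q) (hd : q + 2 ≤ a - b) :
    8 * (a + b) < (a - b + p - 1) ^ 2 - 1 := by
  obtain ⟨d, rfl⟩ : ∃ d, a = b + d := ⟨a - b, by ring⟩
  have hd' : q + 2 ≤ d := by linarith
  have hb : 4 * b ≤ (d - 2) ^ 2 := by nlinarith
  have e : b + d - b = d := by ring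
  rw [e]
  rcases le_or_gt p d with h | h
  · nlinarith [mul_nonneg (sub_nonneg.2 h) (by linarith : (0 : ℤ) ≤ d + 3 * p)]
  · nlinarith [mul_nonneg (by linarith : (0 : ℤ) ≤ p - d - 1) (by linarith : (0 : ℤ) ≤ d - 1)]

/-- The rotated picture of the vertex boundary: `P` and `Q` play the roles of the two colour
classes. -/
def pairBdryCard (P Q : Finset (ℤ × ℤ)) : ℕ := #(diagNbhd P \ Q) + #(diagNbhd Q \ P)

lemma pairBdryCard_comm (P Q : Finset (ℤ × ℤ)) : pairBdryCard P Q = pairBdryCard Q P :=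
  add_comm _ _

/-- The number of columns plus the number of rows met by `T`. -/
def lineCount (T : Finset (ℤ × ℤ)) : ℕ := #(T.image Prod.fst) + #(T.image Prod.snd)

lemma two_le_lineCount {T : Finset (ℤ × ℤ)} (hT : T.Nonempty) : 2 ≤ lineCount T := by
  have h1 := (hT.image Prod.fst).card_pos
  have h2 := (hT.image Prod.snd).card_pos
  rw [lineCount]
  omega

lemma card_add_lineCount_lt {T : Finset (ℤ × ℤ)} (hT : T.Nonempty) :
    #T + lineCount T + 1 ≤ #(diagNbhd T) := by
  have := card_diagNbhd_ge hT
  rw [lineCount]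
  omega

lemma card_add_lineCount_lt_pairBdryCard {P : Finset (ℤ × ℤ)} (hP : P.Nonempty)
    (Q : Finset (ℤ × ℤ)) : #P + lineCount P + 1 ≤ pairBdryCard P Q + #Q := by
  have h1 := card_add_lineCount_lt hP
  have h2 := le_card_sdiff Q (diagNbhd P)
  rw [pairBdryCard]
  omega

lemma lineCount_add_lineCount_lt_pairBdryCard {P Q : Finset (ℤ × ℤ)} (hP : P.Nonempty)
    (hQ : Q.Nonempty) : lineCount P + lineCount Q + 2 ≤ pairBdryCard P Q := by
  have h1 := card_add_lineCount_lt hP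
  have h2 := le_card_sdiff Q (diagNbhd P)
  have h3 := card_add_lineCount_lt hQ
  have h4 := le_card_sdiff P (diagNbhd Q)
  rw [pairBdryCard]
  omega

lemma four_mul_card_le_lineCount_sq (T : Finset (ℤ × ℤ)) : 4 * #T ≤ lineCount T ^ 2 := by
  rw [lineCount]
  have h : #T ≤ #(T.image Prod.fst) * #(T.image Prod.snd) := by
    rw [← card_product]
    exact card_le_card subset_product
  have := four_mul_le_pow_two_add (#(T.image Prod.fst)) (#(T.image Prod.snd))
  rw [mul_assoc] at this
  omega

lemma pair_isoperimetric_of_card_le {P Q : Finset (ℤ × ℤ)} (hP : P.Nonempty) (hQP : #Q ≤ #P) :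
    4 ≤ pairBdryCard P Q ∧
      8 * ((#P : ℤ) + #Q) ≤ ((pairBdryCard P Q : ℤ) - 2) ^ 2 + 4 := by
  have h1 := card_add_lineCount_lt_pairBdryCard hP Q
  have h2 := two_le_lineCount hP
  have h3 := four_mul_card_le_lineCount_sq P
  have h4 := four_mul_card_le_lineCount_sq Q
  have h5 := hP.card_pos
  rcases Q.eq_empty_or_nonempty with rfl | hQ
  · simp only [card_empty, add_zero] at *
    generalize pairBdryCard P ∅ = n at *
    generalize lineCount P = p at *
    generalize #P = a at *
    zify at *
    refine ⟨by omega, ?_⟩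
    have h6 : (a : ℤ) = 1 ∨ (3 : ℤ) ≤ p := by
      by_contra! hc
      have : (p : ℤ) = 2 := by omega
      rw [this] at h3
      omega
    rcases h6 with h6 | h6
    · rw [h6] at *; nlinarith
    · nlinarith [sq_nonneg ((a : ℤ) - 2)]
  · have h6 := lineCount_add_lineCount_lt_pairBdryCard hP hQ
    have h7 := two_le_lineCount hQ
    generalize pairBdryCard P Q = n at *
    generalize lineCount P = p at *
    generalize lineCount Q = q at *
    generalize #P = a at *
    generalize #Q = b at *
    zify at *
    refine ⟨by omega, ?_⟩
    rcases le_or_gt ((a : ℤ) - b) (q + 1) with hd | hd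
    · have := eight_mul_add_le_of_sub_le hQP h3 h4 (by omega) (by omega) hd
      nlinarith
    · have := lt_of_add_two_le_sub h3 h4 (by omega) h7 (by omega)
      nlinarith

/-- The vertex isoperimetric inequality for two colour classes. -/
lemma pair_isoperimetric {P Q : Finset (ℤ × ℤ)} (h : (P ∪ Q).Nonempty) :
    4 ≤ pairBdryCard P Q ∧
      8 * ((#P : ℤ) + #Q) ≤ ((pairBdryCard P Q : ℤ) - 2) ^ 2 + 4 := by
  wlog hQP : #Q ≤ #P generalizing P Q
  · rw [pairBdryCard_comm, add_comm (#P : ℤ)]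
    exact this (by rwa [union_comm]) (by omega)
  refine pair_isoperimetric_of_card_le ?_ hQP
  rw [nonempty_iff_ne_empty]
  rintro rfl
  have : Q = ∅ := by simpa using hQP
  simp [this] at h

/-! ### Rigidity of nearly extremal pairs -/

/-- Two nonempty colour classes of nearly maximal size lie in a rectangle of small perimeter. -/
lemma exists_Ico_of_nearly_extremal {P Q : Finset (ℤ × ℤ)} (hP : P.Nonempty) (hQ : Q.Nonempty)
    (hQP : #Q ≤ #P) (hext : ((pairBdryCard P Q : ℤ) - 2) ^ 2 - 1 ≤ 8 * ((#P : ℤ) + #Q)) :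
    ∃ (i j : ℤ) (w h : ℕ), (w : ℤ) + h + 2 ≤ pairBdryCard P Q ∧
      P ∪ Q ⊆ Ico i (i + w) ×ˢ Ico j (j + h) := by
  have h1 := card_add_lineCount_lt_pairBdryCard hP Q
  have h2 := two_le_lineCount hP
  have h3 := four_mul_card_le_lineCount_sq P
  have h4 := four_mul_card_le_lineCount_sq Q
  have h6 := lineCount_add_lineCount_lt_pairBdryCard hP hQ
  have h7 := two_le_lineCount hQ
  -- The unbalanced case contradicts `hext`, and one more boundary point would raise (n - 2)² - 1
  -- above (p + q)² + 4, as p + q ≥ 4.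
  have hn : pairBdryCard P Q = lineCount P + lineCount Q + 2 := by
    generalize pairBdryCard P Q = n at *
    generalize lineCount P = p at *
    generalize lineCount Q = q at *
    generalize #P = a at *
    generalize #Q = b at *
    zify at *
    rcases le_or_gt ((a : ℤ) - b) (q + 1) with hd | hd
    · have := eight_mul_add_le_of_sub_le hQP h3 h4 (by omega) (by omega) hd
      by_contra hne
      have : (p : ℤ) + q + 3 ≤ n := by omega
      nlinarith
    · have := lt_of_add_two_le_sub h3 h4 (by omega) h7 (by omega)
      nlinarith
  have a1 := card_diagNbhd_ge_fst P
  have a2 := card_diagNbhd_ge_snd P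
  have a3 := card_diagNbhd_ge_fst Q
  have a4 := card_diagNbhd_ge_snd Q
  have b1 := card_add_lineCount_lt hP
  have b2 := card_add_lineCount_lt hQ
  have c1 := le_card_sdiff Q (diagNbhd P)
  have c2 := le_card_sdiff P (diagNbhd Q)
  have d1 := card_sdiff_add_card (diagNbhd P) Q
  have d2 := card_sdiff_add_card (diagNbhd Q) P
  have hn' := hn
  rw [pairBdryCard] at hn'
  -- Equality in the sum makes each summand tight: removing Q from N(P) must remove all of Q.
  have hQs : Q ⊆ diagNbhd P := by
    have : diagNbhd P = diagNbhd P ∪ Q := eq_of_subset_of_card_le subset_union_left (by omega)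
    rw [this]
    exact subset_union_right
  have hPs : P ⊆ diagNbhd Q := by
    have : diagNbhd Q = diagNbhd Q ∪ P := eq_of_subset_of_card_le subset_union_left (by omega)
    rw [this]
    exact subset_union_right
  simp only [lineCount] at *
  obtain ⟨i, hi⟩ := union_eq_Ico_of_subset_stepNbhd (hP.image Prod.fst)
    (image_fst_diagNbhd Q ▸ image_subset_image hPs) (image_fst_diagNbhd P ▸ image_subset_image hQs)
    (by omega) (by omega)
  obtain ⟨j, hj⟩ := union_eq_Ico_of_subset_stepNbhd (hP.image Prod.snd)
    (image_snd_diagNbhd Q ▸ image_subset_image hPs) (image_snd_diagNbhd P ▸ image_subset_image hQs)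
    (by omega) (by omega)
  refine ⟨i, j, #(P.image Prod.fst ∪ Q.image Prod.fst),
    #(P.image Prod.snd ∪ Q.image Prod.snd), ?_, fun x hx => mem_product.2 ⟨?_, ?_⟩⟩
  rotate_left
  · rw [← hi, ← image_union]
    exact mem_image_of_mem _ hx
  · rw [← hj, ← image_union]
    exact mem_image_of_mem _ hx
  · have := card_union_le (P.image Prod.fst) (Q.image Prod.fst)
    have := card_union_le (P.image Prod.snd) (Q.image Prod.snd)
    omega

lemma subset_Ico_of_card_stepNbhd_pair_le {x y : ℤ} (hxy : x ≠ y)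
    (h : #(stepNbhd {x, y}) ≤ 3) : ∃ i : ℤ, ({x, y} : Finset ℤ) ⊆ Ico i (i + 3) := by
  wlog hlt : x < y generalizing x y
  · rw [pair_comm] at h ⊢
    exact this hxy.symm h (by omega)
  have hy : y = x + 2 := by
    by_contra hne
    have hsub : ({x - 1, x + 1, y - 1, y + 1} : Finset ℤ) ⊆ stepNbhd {x, y} := by
      intro z hz
      rw [mem_stepNbhd]
      simp only [mem_insert, mem_singleton] at hz ⊢
      omega
    have hcard : #({x - 1, x + 1, y - 1, y + 1} : Finset ℤ) = 4 := by
      rw [card_insert_of_notMem, card_insert_of_notMem, card_pair] <;>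
        first | omega | (simp only [mem_insert, mem_singleton]; omega)
    have := card_le_card hsub
    omega
  refine ⟨x, fun z hz => ?_⟩
  simp only [mem_insert, mem_singleton] at hz
  rw [mem_Ico]
  omega

/-- A single colour class of nearly maximal size lies in a rectangle of small perimeter. -/
lemma exists_Ico_of_nearly_extremal_empty {P : Finset (ℤ × ℤ)} (hP : P.Nonempty)
    (hext : ((pairBdryCard P ∅ : ℤ) - 2) ^ 2 - 1 ≤ 8 * (#P : ℤ)) :
    ∃ (i j : ℤ) (w h : ℕ), (w : ℤ) + h + 2 ≤ pairBdryCard P ∅ ∧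
      P ⊆ Ico i (i + w) ×ˢ Ico j (j + h) := by
  have h1 := card_add_lineCount_lt_pairBdryCard hP ∅
  have h2 := two_le_lineCount hP
  have h3 := four_mul_card_le_lineCount_sq P
  -- Here n ≥ a + p + 1; for a ≥ 3 one has p ≥ 4, and (a + 3)² - 1 > 8a.
  have hle : #P ≤ 2 ∧ (#P = 2 → lineCount P = 3 ∧ pairBdryCard P ∅ = 6) := by
    simp only [card_empty, add_zero] at *
    generalize pairBdryCard P ∅ = n at *
    generalize lineCount P = p at *
    generalize #P = a at *
    zify at *
    have ha : (a : ℤ) ≤ 2 := by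
      by_contra! hc
      have hp4 : (4 : ℤ) ≤ p := by nlinarith
      nlinarith
    refine ⟨ha, fun ha2 => ?_⟩
    have hp3 : (3 : ℤ) ≤ p := by
      by_contra! hc
      have : (p : ℤ) = 2 := by omega
      rw [this] at h3
      omega
    have hn : (n : ℤ) ≤ 6 := by nlinarith
    omega
  obtain ⟨hle2, h2eq⟩ := hle
  have hpos := hP.card_pos
  rcases (by omega : #P = 1 ∨ #P = 2) with hc | hc
  · obtain ⟨v, rfl⟩ := card_eq_one.1 hc
    refine ⟨v.1, v.2, 1, 1, ?_, ?_⟩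
    · simp only [card_empty] at h1
      omega
    · rw [singleton_subset_iff, mem_product, mem_Ico, mem_Ico]
      omega
  · obtain ⟨hl, hn⟩ := h2eq hc
    obtain ⟨u, v, huv, rfl⟩ := card_eq_two.1 hc
    have a1 := card_diagNbhd_ge_fst {u, v}
    have a2 := card_diagNbhd_ge_snd {u, v}
    have hd : #(diagNbhd {u, v}) ≤ 6 := by
      rw [pairBdryCard, sdiff_empty] at hn
      omega
    rw [hn]
    simp only [lineCount, image_insert, image_singleton] at hl a1 a2
    rw [hc] at a1 a2
    have hsub : ∀ s t : Finset ℤ, ({u.1, v.1} : Finset ℤ) ⊆ s → ({u.2, v.2} : Finset ℤ) ⊆ t →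
        ({u, v} : Finset (ℤ × ℤ)) ⊆ s ×ˢ t := by
      intro s t hs ht
      simp only [insert_subset_iff, singleton_subset_iff, mem_product] at *
      tauto
    by_cases h1 : u.1 = v.1
    · have h2 : u.2 ≠ v.2 := fun h2 => huv (Prod.ext h1 h2)
      rw [card_pair h2] at hl
      obtain ⟨j, hj⟩ := subset_Ico_of_card_stepNbhd_pair_le h2 (by omega)
      refine ⟨u.1, j, 1, 3, by norm_num, hsub _ _ ?_ hj⟩
      simp [← h1]
    · rw [card_pair h1] at hl
      obtain ⟨i, hi⟩ := subset_Ico_of_card_stepNbhd_pair_le h1 (by omega)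
      have h2 : u.2 = v.2 := by
        by_contra h2
        rw [card_pair h2] at hl
        omega
      refine ⟨i, u.2, 3, 1, by norm_num, hsub _ _ hi ?_⟩
      simp [← h2]

/-- Two colour classes of nearly maximal total size lie in a rectangle of small perimeter. -/
lemma pair_subset_rectangle_of_nearly_extremal {P Q : Finset (ℤ × ℤ)} (h : (P ∪ Q).Nonempty)
    (hext : ((pairBdryCard P Q : ℤ) - 2) ^ 2 - 1 ≤ 8 * ((#P : ℤ) + #Q)) :
    ∃ (i j : ℤ) (w h : ℕ), (w : ℤ) + h + 2 ≤ pairBdryCard P Q ∧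
      P ∪ Q ⊆ Ico i (i + w) ×ˢ Ico j (j + h) := by
  wlog hQP : #Q ≤ #P generalizing P Q
  · rw [pairBdryCard_comm, add_comm (#P : ℤ)] at hext
    rw [pairBdryCard_comm, union_comm]
    exact this (by rwa [union_comm]) hext (by omega)
  have hP : P.Nonempty := by
    rw [nonempty_iff_ne_empty]
    rintro rfl
    have : Q = ∅ := by simpa using hQP
    simp [this] at h
  rcases Q.eq_empty_or_nonempty with rfl | hQ
  · rw [union_empty]
    exact exists_Ico_of_nearly_extremal_empty hP (by simpa using hext)
  · exact exists_Ico_of_nearly_extremal hP hQ hQP hext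

/-! ### Lattice rectangles -/

/-- The points of a rectangle whose coordinates have the same parity. -/
noncomputable def latticeRect (i j : ℤ) (w h : ℕ) : Finset (ℤ × ℤ) :=
  (Ico i (i + w) ×ˢ Ico j (j + h)).filter (fun p => Even (p.1 + p.2))

lemma mem_latticeRect {i j : ℤ} {w h : ℕ} {p : ℤ × ℤ} : p ∈ latticeRect i j w h ↔
    ((i ≤ p.1 ∧ p.1 < i + w) ∧ j ≤ p.2 ∧ p.2 < j + h) ∧ Even (p.1 + p.2) := by
  simp only [latticeRect, mem_filter, mem_product, mem_Ico]

lemma sum_Ico_negOnePow (i : ℤ) (w : ℕ) :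
    ∑ u ∈ Ico i (i + w), (u.negOnePow : ℤ) = if Even w then 0 else (i.negOnePow : ℤ) := by
  induction w with
  | zero => simp
  | succ w ih =>
    have hI : Ico i (i + (w + 1 : ℕ)) = insert (i + w) (Ico i (i + w)) := by
      ext x
      simp only [mem_insert, mem_Ico]
      push_cast
      omega
    rw [hI, sum_insert (by simp), ih, Int.negOnePow_add]
    rcases Nat.even_or_odd w with hw | hw
    · have h1 : ¬ Even (w + 1) := by simpa [Nat.even_add_one] using hw
      rw [if_pos hw, if_neg h1, Int.negOnePow_even w (by exact_mod_cast hw)]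
      simp
    · have h1 : Even (w + 1) := hw.add_one
      rw [if_neg (Nat.not_even_iff_odd.2 hw), if_pos h1,
        Int.negOnePow_odd w (by exact_mod_cast hw)]
      simp

/-- Twice the indicator of even x + y is 1 + (-1)^x (-1)^y, and the sum of the signs factors over
the two sides. -/
lemma two_mul_card_latticeRect (i j : ℤ) (w h : ℕ) :
    2 * (#(latticeRect i j w h) : ℤ) =
      w * h + if Even w ∨ Even h then 0 else ((i + j).negOnePow : ℤ) := by
  have h1 : 2 * (#(latticeRect i j w h) : ℤ) =
      ∑ p ∈ Ico i (i + w) ×ˢ Ico j (j + h), (1 + (p.1.negOnePow : ℤ) * (p.2.negOnePow : ℤ)) := by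
    rw [latticeRect, card_filter]
    push_cast
    rw [mul_sum]
    refine sum_congr rfl fun p _ => ?_
    have hm : (p.1.negOnePow : ℤ) * (p.2.negOnePow : ℤ) = ((p.1 + p.2).negOnePow : ℤ) := by
      rw [Int.negOnePow_add]
      simp
    rw [hm]
    split_ifs with he
    · rw [Int.negOnePow_even _ he]
      simp
    · rw [Int.negOnePow_odd _ (Int.not_even_iff_odd.1 he)]
      simp
  rw [h1, sum_add_distrib, sum_product, sum_product]
  simp only [← mul_sum, ← sum_mul, sum_Ico_negOnePow, Int.negOnePow_add]
  by_cases hw : Even w <;> by_cases hh : Even h <;> simp [hw, hh]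

lemma two_mul_card_latticeRect_le {i j : ℤ} {w h : ℕ} :
    2 * (#(latticeRect i j w h) : ℤ) ≤ w * h + 1 := by
  rw [two_mul_card_latticeRect]
  split_ifs
  · simp
  · rcases Int.units_eq_one_or (i + j).negOnePow with h | h <;> simp [h]

lemma mem_diagNbhd_iff_exists {T : Finset (ℤ × ℤ)} {z : ℤ × ℤ} : z ∈ diagNbhd T ↔
    ∃ p ∈ T, (z.1 = p.1 + 1 ∨ z.1 = p.1 - 1) ∧ (z.2 = p.2 + 1 ∨ z.2 = p.2 - 1) := by
  obtain ⟨x, y⟩ := z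
  rw [mem_diagNbhd]
  constructor
  · rintro ((h | h) | h | h) <;> exact ⟨_, h, by simp⟩
  · rintro ⟨⟨a, b⟩, hp, h1, h2⟩
    dsimp only at h1 h2
    rcases h1 with rfl | rfl <;> rcases h2 with rfl | rfl <;> simp [hp]

/-- The neighbourhood lies in the rectangle enlarged by one on every side, which has the same parity
correction, so the sizes differ by ((w + 2)(h + 2) - wh)/2. -/
lemma card_diagNbhd_latticeRect_sdiff_le (i j : ℤ) (w h : ℕ) :
    #(diagNbhd (latticeRect i j w h) \ latticeRect i j w h) ≤ w + h + 2 := by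
  have hsub : latticeRect i j w h ⊆ latticeRect (i - 1) (j - 1) (w + 2) (h + 2) := by
    intro p
    simp only [mem_latticeRect]
    push_cast
    rintro ⟨h1, h2⟩
    exact ⟨by omega, h2⟩
  have hdiag : diagNbhd (latticeRect i j w h) ⊆ latticeRect (i - 1) (j - 1) (w + 2) (h + 2) := by
    intro z hz
    obtain ⟨p, hp, h1, h2⟩ := mem_diagNbhd_iff_exists.1 hz
    rw [mem_latticeRect] at hp ⊢
    obtain ⟨hp1, hp2⟩ := hp
    push_cast
    refine ⟨by omega, ?_⟩
    rw [Int.even_iff] at hp2 ⊢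
    omega
  have h1 := card_le_card (sdiff_subset_sdiff hdiag (Subset.refl (latticeRect i j w h)))
  have h2 := card_sdiff_add_card_eq_card hsub
  have h3 := two_mul_card_latticeRect i j w h
  have h4 := two_mul_card_latticeRect (i - 1) (j - 1) (w + 2) (h + 2)
  have e1 : (i - 1 + (j - 1)).negOnePow = (i + j).negOnePow := by
    rw [show i - 1 + (j - 1) = i + j - 2 by ring, Int.negOnePow_sub,
      Int.negOnePow_even 2 (by decide), mul_one]
  have e2 : Even (w + 2) ↔ Even w := by simp [Nat.even_add]
  have e3 : Even (h + 2) ↔ Even h := by simp [Nat.even_add]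
  rw [e1] at h4
  simp only [e2, e3] at h4
  push_cast at h4
  have h5 : (#(latticeRect (i - 1) (j - 1) (w + 2) (h + 2)) : ℤ) =
      #(latticeRect i j w h) + (w + h + 2) := by linarith
  omega

/-! ### Rotated coordinates -/

/-- The coordinates `(y - x, y + x)`. -/
def rot (p : ℤ × ℤ) : ℤ × ℤ := (p.2 - p.1, p.2 + p.1)

lemma rot_injective : Function.Injective rot := by
  rintro ⟨a, b⟩ ⟨c, d⟩ h
  simp only [rot, Prod.mk.injEq] at h ⊢
  omega

lemma even_rot (p : ℤ × ℤ) : Even ((rot p).1 + (rot p).2) :=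
  ⟨p.2, by simp only [rot]; ring⟩

lemma exists_rot_eq {z : ℤ × ℤ} (hz : Even (z.1 + z.2)) : ∃ p, rot p = z := by
  obtain ⟨k, hk⟩ := hz
  refine ⟨(k - z.1, k), Prod.ext ?_ ?_⟩ <;> simp only [rot] <;> omega

lemma latticeGraph_adj_iff {p q : ℤ × ℤ} : latticeGraph.Adj p q ↔
    ((rot p).1 = (rot q).1 + 1 ∨ (rot p).1 = (rot q).1 - 1) ∧
      ((rot p).2 = (rot q).2 + 1 ∨ (rot p).2 = (rot q).2 - 1) := by
  simp only [latticeGraph, rot]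
  rcases abs_cases (p.1 - q.1) with h1 | h1 <;> rcases abs_cases (p.2 - q.2) with h2 | h2 <;>
    omega

/-- The colour classes of a finite set in rotated coordinates. -/
lemma exists_colour_classes {A : Set (ℤ × ℤ)} (hA : A.Finite) : ∃ P Q : Finset (ℤ × ℤ),
    (↑(P ∪ Q) : Set (ℤ × ℤ)) = rot '' A ∧ A.ncard = #P + #Q ∧ (bdry A).Finite ∧
      (bdry A).ncard = pairBdryCard P Q := by
  set T := hA.toFinset.image rot with hT
  have hTmem : ∀ p, rot p ∈ T ↔ p ∈ A := fun p => by
    rw [hT, rot_injective.mem_finset_image, Set.Finite.mem_toFinset]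
  have hTrot : ∀ z ∈ T, ∃ p ∈ A, rot p = z := fun z hz => by
    obtain ⟨p, hp, h⟩ := mem_image.1 hz
    exact ⟨p, hA.mem_toFinset.1 hp, h⟩
  set P := T.filter (fun z => Even z.1) with hP
  set Q := T.filter (fun z => ¬ Even z.1) with hQ
  have hbd : rot '' bdry A = ↑((diagNbhd P \ Q) ∪ (diagNbhd Q \ P)) := by
    ext z
    rw [mem_coe, mem_union, mem_sdiff, mem_sdiff]
    constructor
    · rintro ⟨u, ⟨hu, v, hv, huv⟩, rfl⟩
      have hu' : rot u ∉ T := fun h => hu ((hTmem u).1 h)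
      have hv' := (hTmem v).2 hv
      rw [latticeGraph_adj_iff] at huv
      by_cases he : Even (rot v).1
      · exact Or.inl ⟨mem_diagNbhd_iff_exists.2 ⟨_, mem_filter.2 ⟨hv', he⟩, huv⟩,
          fun h => hu' (mem_filter.1 h).1⟩
      · exact Or.inr ⟨mem_diagNbhd_iff_exists.2 ⟨_, mem_filter.2 ⟨hv', he⟩, huv⟩,
          fun h => hu' (mem_filter.1 h).1⟩
    · have aux : ∀ v ∈ A, ((z.1 = (rot v).1 + 1 ∨ z.1 = (rot v).1 - 1) ∧
          (z.2 = (rot v).2 + 1 ∨ z.2 = (rot v).2 - 1)) → z ∉ T → z ∈ rot '' bdry A := by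
        intro v hv h hz
        have hev := even_rot v
        -- A diagonal step preserves the parity of the coordinate sum, so z is in the image of
        -- `rot`.
        obtain ⟨u, rfl⟩ : ∃ u, rot u = z := exists_rot_eq (by rw [Int.even_iff] at *; omega)
        exact ⟨u, ⟨fun hu => hz ((hTmem u).2 hu), v, hv, latticeGraph_adj_iff.2 h⟩, rfl⟩
      rintro (⟨h1, h2⟩ | ⟨h1, h2⟩) <;> obtain ⟨p, hp, h⟩ := mem_diagNbhd_iff_exists.1 h1 <;>
        obtain ⟨hpT, hpe⟩ := mem_filter.1 hp <;> obtain ⟨v, hv, rfl⟩ := hTrot p hpT <;>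
        refine aux v hv h fun hz => h2 (mem_filter.2 ⟨hz, ?_⟩) <;>
        rw [Int.even_iff] at * <;> omega
  have hdisj : Disjoint (diagNbhd P \ Q) (diagNbhd Q \ P) := by
    rw [Finset.disjoint_left]
    intro z h1 h2
    obtain ⟨p, hp, hp1, -⟩ := mem_diagNbhd_iff_exists.1 (mem_sdiff.1 h1).1
    obtain ⟨q, hq, hq1, -⟩ := mem_diagNbhd_iff_exists.1 (mem_sdiff.1 h2).1
    have hpe := (mem_filter.1 hp).2
    have hqe := (mem_filter.1 hq).2
    rw [Int.even_iff] at *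
    omega
  refine ⟨P, Q, ?_, ?_, ?_, ?_⟩
  · rw [hP, hQ, filter_union_filter_not_eq, hT, coe_image, hA.coe_toFinset]
  · rw [hP, hQ, card_filter_add_card_filter_not, hT, card_image_of_injective _ rot_injective,
      Set.ncard_eq_toFinset_card A hA]
  · refine Set.Finite.of_finite_image ?_ rot_injective.injOn
    rw [hbd]
    exact finite_toSet _
  · rw [← Set.ncard_image_of_injective _ rot_injective, hbd, Set.ncard_coe_finset,
      card_union_of_disjoint hdisj, pairBdryCard]

lemma finite_bdry {A : Set (ℤ × ℤ)} (hA : A.Finite) : (bdry A).Finite := by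
  obtain ⟨P, Q, -, -, h, -⟩ := exists_colour_classes hA
  exact h

/-- The vertex isoperimetric inequality in the integer lattice. -/
lemma isoperimetric {A : Set (ℤ × ℤ)} (hA : A.Finite) (hne : A.Nonempty) :
    4 ≤ (bdry A).ncard ∧ 8 * (A.ncard : ℤ) ≤ (((bdry A).ncard : ℤ) - 2) ^ 2 + 4 := by
  obtain ⟨P, Q, h1, h2, -, h3⟩ := exists_colour_classes hA
  rw [h3, h2]
  push_cast
  refine pair_isoperimetric ?_
  rw [← coe_nonempty, h1]
  exact hne.image _

/-! ### Nearly extremal sets are rotated rectangles -/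

/-- A finite set of nearly maximal size for its boundary. -/
def NearlyExtremal (A : Set (ℤ × ℤ)) : Prop :=
  A.Finite ∧ (((bdry A).ncard : ℤ) - 2) ^ 2 - 1 ≤ 8 * (A.ncard : ℤ)

/-- The lattice points of a rectangle in rotated coordinates. -/
def rotRect (i j : ℤ) (w h : ℕ) : Set (ℤ × ℤ) :=
  {p | i ≤ p.2 - p.1 ∧ p.2 - p.1 < i + w ∧ j ≤ p.2 + p.1 ∧ p.2 + p.1 < j + h}

lemma rot_image_rotRect (i j : ℤ) (w h : ℕ) : rot '' rotRect i j w h = latticeRect i j w h := by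
  ext z
  rw [mem_coe, mem_latticeRect]
  constructor
  · rintro ⟨p, ⟨h1, h2, h3, h4⟩, rfl⟩
    exact ⟨⟨⟨h1, h2⟩, h3, h4⟩, even_rot p⟩
  · rintro ⟨⟨⟨h1, h2⟩, h3, h4⟩, h5⟩
    obtain ⟨p, rfl⟩ := exists_rot_eq h5
    exact ⟨p, ⟨h1, h2, h3, h4⟩, rfl⟩

lemma finite_rotRect (i j : ℤ) (w h : ℕ) : (rotRect i j w h).Finite := by
  refine Set.Finite.of_finite_image ?_ rot_injective.injOn
  rw [rot_image_rotRect]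
  exact finite_toSet _

lemma ncard_rotRect (i j : ℤ) (w h : ℕ) : (rotRect i j w h).ncard = #(latticeRect i j w h) := by
  rw [← Set.ncard_image_of_injective _ rot_injective, rot_image_rotRect, Set.ncard_coe_finset]

lemma ncard_bdry_rotRect_le (i j : ℤ) (w h : ℕ) : (bdry (rotRect i j w h)).ncard ≤ w + h + 2 := by
  refine le_trans ?_ (card_diagNbhd_latticeRect_sdiff_le i j w h)
  rw [← Set.ncard_image_of_injective _ rot_injective, ← Set.ncard_coe_finset]
  refine Set.ncard_le_ncard ?_ (finite_toSet _)
  rintro _ ⟨u, ⟨hu, v, hv, huv⟩, rfl⟩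
  rw [mem_coe, mem_sdiff, ← mem_coe (s := latticeRect i j w h), ← rot_image_rotRect]
  refine ⟨mem_diagNbhd_iff_exists.2 ⟨rot v, ?_, latticeGraph_adj_iff.1 huv⟩, ?_⟩
  · rw [← mem_coe, ← rot_image_rotRect]
    exact ⟨v, hv, rfl⟩
  · rwa [rot_injective.mem_set_image]

lemma stdBox_eq_rotRect (α β : ℕ) : stdBox α β = rotRect 0 0 (α + 1) (β + 1) := by
  ext p
  simp only [stdBox, rotRect, Set.mem_ofPred_eq]
  push_cast
  omega

/-- A nearly extremal set is a rectangle. -/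
lemma NearlyExtremal.exists_eq_rotRect {A : Set (ℤ × ℤ)} (hA : NearlyExtremal A)
    (hne : A.Nonempty) : ∃ (i j : ℤ) (w h : ℕ), A = rotRect i j w h ∧
      ((w : ℤ) + h) ^ 2 - 1 ≤ 8 * (#(latticeRect i j w h) : ℤ) := by
  obtain ⟨hfin, hext⟩ := hA
  obtain ⟨P, Q, h1, h2, -, h3⟩ := exists_colour_classes hfin
  have hPQ : (P ∪ Q).Nonempty := by
    rw [← coe_nonempty, h1]
    exact hne.image _
  have hn := (isoperimetric hfin hne).1
  rw [h3, h2] at hext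
  push_cast at hext
  obtain ⟨i, j, w, h, hwh, hsub⟩ := pair_subset_rectangle_of_nearly_extremal hPQ hext
  have hsub' : A ⊆ rotRect i j w h := by
    intro p hp
    have hp' : rot p ∈ P ∪ Q := by
      rw [← mem_coe, h1]
      exact ⟨p, hp, rfl⟩
    have := hsub hp'
    rw [mem_product, mem_Ico, mem_Ico] at this
    exact ⟨this.1.1, this.1.2, this.2.1, this.2.2⟩
  have hsq : ((w : ℤ) + h) ^ 2 ≤ ((pairBdryCard P Q : ℤ) - 2) ^ 2 := by
    have : (0 : ℤ) ≤ (w : ℤ) + h := by positivity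
    exact pow_le_pow_left₀ this (by linarith) 2
  -- Eight times the left side is at most (w + h)² + 4, eight times the right at least (w + h)² - 1;
  -- integrality closes the gap of 5.
  have hle : #(latticeRect i j w h) ≤ #P + #Q := by
    have := two_mul_card_latticeRect_le (i := i) (j := j) (w := w) (h := h)
    zify
    nlinarith [sq_nonneg ((w : ℤ) - h)]
  have heq : A = rotRect i j w h :=
    Set.eq_of_subset_of_ncard_le hsub' (by rw [ncard_rotRect, h2]; exact hle) (finite_rotRect i j w h)
  refine ⟨i, j, w, h, heq, ?_⟩
  rw [← ncard_rotRect, ← heq, h2]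
  push_cast
  linarith

/-! ### Congruences -/

lemma Congruent.trans {A B C : Set (ℤ × ℤ)} (h1 : Congruent A B) (h2 : Congruent B C) :
    Congruent A C := by
  obtain ⟨φ, rfl⟩ := h1
  obtain ⟨ψ, rfl⟩ := h2
  exact ⟨φ.trans ψ, by rw [Set.image_image]; rfl⟩

lemma Congruent.finite_iff {A B : Set (ℤ × ℤ)} (h : Congruent A B) : A.Finite ↔ B.Finite := by
  obtain ⟨φ, rfl⟩ := h
  exact (Set.finite_image_iff φ.injective.injOn).symm

lemma Congruent.ncard_eq {A B : Set (ℤ × ℤ)} (h : Congruent A B) : A.ncard = B.ncard := by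
  obtain ⟨φ, rfl⟩ := h
  exact (Set.ncard_image_of_injective _ φ.injective).symm

lemma Congruent.ncard_bdry_eq {A B : Set (ℤ × ℤ)} (h : Congruent A B) :
    (bdry A).ncard = (bdry B).ncard := by
  obtain ⟨φ, rfl⟩ := h
  rw [← Set.ncard_image_of_injective (bdry A) φ.injective]
  congr 1
  ext z
  obtain ⟨u, rfl⟩ := φ.surjective z
  rw [φ.injective.mem_set_image]
  simp only [bdry, vertexBoundary, Set.mem_ofPred_eq, φ.injective.mem_set_image,
    Set.exists_mem_image, φ.map_adj_iff]

lemma Congruent.nearlyExtremal {A B : Set (ℤ × ℤ)} (h : Congruent A B) (hB : NearlyExtremal B) :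
    NearlyExtremal A := by
  refine ⟨h.finite_iff.2 hB.1, ?_⟩
  rw [h.ncard_eq, h.ncard_bdry_eq]
  exact hB.2

lemma congruent_of_equiv {A B : Set (ℤ × ℤ)} (e : ℤ × ℤ ≃ ℤ × ℤ)
    (he : ∀ p q, latticeGraph.Adj (e p) (e q) ↔ latticeGraph.Adj p q)
    (h : ∀ p, e p ∈ B ↔ p ∈ A) : Congruent A B := by
  refine ⟨⟨e, fun {p q} => he p q⟩, ?_⟩
  ext z
  obtain ⟨p, rfl⟩ := e.surjective z
  rw [h]
  exact e.injective.mem_set_image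

/-- Translation. -/
lemma congruent_rotRect_zero (k l : ℤ) (w h : ℕ) :
    Congruent (rotRect (l - k) (l + k) w h) (rotRect 0 0 w h) := by
  refine congruent_of_equiv (Equiv.addRight (-k, -l)) ?_ ?_
  · intro p q
    simp [latticeGraph]
  · intro p
    simp only [rotRect, Set.mem_ofPred_eq, Equiv.coe_addRight, Prod.fst_add, Prod.snd_add]
    omega

lemma congruent_rotRect_reflect_fst (i j : ℤ) (w h : ℕ) :
    Congruent (rotRect i j w h) (rotRect (1 - i - w) j w h) := by
  refine congruent_of_equiv (Equiv.prodComm ℤ ℤ) ?_ ?_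
  · intro p q
    simp only [latticeGraph, Equiv.prodComm_apply, Prod.fst_swap, Prod.snd_swap]
    rw [add_comm]
  · intro p
    simp only [rotRect, Set.mem_ofPred_eq, Equiv.prodComm_apply, Prod.fst_swap, Prod.snd_swap]
    omega

lemma congruent_rotRect_swap (i j : ℤ) (w h : ℕ) :
    Congruent (rotRect i j w h) (rotRect j i h w) := by
  refine congruent_of_equiv ((Equiv.neg ℤ).prodCongr (Equiv.refl ℤ)) ?_ ?_
  · intro p q
    simp only [latticeGraph, Equiv.prodCongr_apply, Prod.map_fst, Prod.map_snd, Equiv.neg_apply,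
      Equiv.refl_apply]
    rw [neg_sub_neg, abs_sub_comm]
  · intro p
    simp only [rotRect, Set.mem_ofPred_eq, Equiv.prodCongr_apply, Prod.map_fst, Prod.map_snd,
      Equiv.neg_apply, Equiv.refl_apply]
    omega

lemma congruent_rotRect_zero_of_even {i j : ℤ} (hij : Even (i + j)) (w h : ℕ) :
    Congruent (rotRect i j w h) (rotRect 0 0 w h) := by
  obtain ⟨k, hk⟩ := hij
  have := congruent_rotRect_zero (k - i) k w h
  rwa [show k - (k - i) = i by ring, show k + (k - i) = j by omega] at this

/-- Translations preserve the parity of i + j; when w is even, the reflection i ↦ 1 - i - w changes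
it. -/
lemma congruent_rotRect_zero_of_even_width (i j : ℤ) {w : ℕ} (hw : Even w) (h : ℕ) :
    Congruent (rotRect i j w h) (rotRect 0 0 w h) := by
  by_cases hij : Even (i + j)
  · exact congruent_rotRect_zero_of_even hij w h
  · refine (congruent_rotRect_reflect_fst i j w h).trans (congruent_rotRect_zero_of_even ?_ w h)
    have hw' : Even (w : ℤ) := by exact_mod_cast hw
    rw [Int.even_iff] at *
    omega

lemma congruent_rotRect_zero_of_even_or (i j : ℤ) {w h : ℕ} (hwh : Even w ∨ Even h) :
    Congruent (rotRect i j w h) (rotRect 0 0 w h) := by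
  rcases hwh with hw | hh
  · exact congruent_rotRect_zero_of_even_width i j hw h
  · exact ((congruent_rotRect_swap i j w h).trans
      (congruent_rotRect_zero_of_even_width j i hh w)).trans (congruent_rotRect_swap 0 0 h w)

/-! ### Classification of nearly extremal sets -/

/-- The boxes that occur in the classification of efficient sets. -/
def IsExtremalBox (A : Set (ℤ × ℤ)) : Prop :=
  ∃ n : ℕ, Congruent A (stdBox n n) ∨ Congruent A (stdBox n (n + 1)) ∨
    Congruent A (stdBox (2 * n) (2 * n + 2))

lemma isExtremalBox_rotRect_zero {w h : ℕ} (hw : 1 ≤ w) (hwh : w ≤ h)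
    (hc : h ≤ w + 1 ∨ h = w + 2 ∧ Odd w) : IsExtremalBox (rotRect 0 0 w h) := by
  have hrefl : Congruent (rotRect 0 0 w h) (stdBox (w - 1) (h - 1)) := by
    rw [stdBox_eq_rotRect, Nat.sub_add_cancel hw, Nat.sub_add_cancel (hw.trans hwh)]
    exact congruent_rotRect_zero_of_even (by simp) w h
  rcases hc with hc | ⟨rfl, k, rfl⟩
  · refine ⟨w - 1, ?_⟩
    rcases (by omega : h = w ∨ h = w + 1) with rfl | rfl
    · exact Or.inl hrefl
    · refine Or.inr (Or.inl ?_)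
      rwa [show w + 1 - 1 = w - 1 + 1 by omega] at hrefl
  · exact ⟨k, Or.inr (Or.inr hrefl)⟩

lemma NearlyExtremal.isExtremalBox {A : Set (ℤ × ℤ)} (hA : NearlyExtremal A)
    (hne : A.Nonempty) : IsExtremalBox A := by
  obtain ⟨i, j, w, h, rfl, hc⟩ := hA.exists_eq_rotRect hne
  have hpos : 1 ≤ w ∧ 1 ≤ h := by
    obtain ⟨p, h1, h2, h3, h4⟩ := hne
    omega
  have hcard := two_mul_card_latticeRect i j w h
  obtain ⟨hcong, hshape⟩ : Congruent (rotRect i j w h) (rotRect 0 0 w h) ∧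
      ((w ≤ h + 1 ∧ h ≤ w + 1) ∨ (Odd w ∧ Odd h ∧ w ≤ h + 2 ∧ h ≤ w + 2)) := by
    by_cases he : Even w ∨ Even h
    · rw [if_pos he] at hcard
      refine ⟨congruent_rotRect_zero_of_even_or i j he, Or.inl ?_⟩
      have hsq : ((w : ℤ) - h) ^ 2 ≤ 1 := by nlinarith
      have := abs_le.1 ((sq_le_one_iff_abs_le_one _).1 hsq)
      omega
    · rw [if_neg he] at hcard
      rw [not_or, Nat.not_even_iff_odd, Nat.not_even_iff_odd] at he
      by_cases hij : Even (i + j)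
      · rw [Int.negOnePow_even _ hij] at hcard
        refine ⟨congruent_rotRect_zero_of_even hij w h, Or.inr ⟨he.1, he.2, ?_⟩⟩
        have hsq : ((w : ℤ) - h) ^ 2 < 3 ^ 2 := by push_cast at hcard; nlinarith
        have := abs_lt_of_sq_lt_sq' hsq (by norm_num)
        omega
      -- Odd sides with a corner of the wrong parity (the shape of the shifted boxes) would give (w
      -- - h)² ≤ -3.
      · rw [Int.negOnePow_odd _ (Int.not_even_iff_odd.1 hij)] at hcard
        push_cast at hcard
        nlinarith [sq_nonneg ((w : ℤ) - h)]
  have key : IsExtremalBox (rotRect 0 0 w h) := by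
    rcases le_total w h with hle | hle
    · refine isExtremalBox_rotRect_zero hpos.1 hle ?_
      simp only [Nat.odd_iff] at *
      omega
    · obtain ⟨n, hn⟩ := isExtremalBox_rotRect_zero hpos.2 hle (by
        simp only [Nat.odd_iff] at *
        omega)
      have hs := congruent_rotRect_swap 0 0 w h
      exact ⟨n, hn.imp hs.trans (Or.imp hs.trans hs.trans)⟩
  obtain ⟨n, hn⟩ := key
  exact ⟨n, hn.imp hcong.trans (Or.imp hcong.trans hcong.trans)⟩

lemma stdBox_nonempty (α β : ℕ) : (stdBox α β).Nonempty := ⟨(0, 0), by simp [stdBox]⟩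

lemma finite_stdBox (α β : ℕ) : (stdBox α β).Finite := by
  rw [stdBox_eq_rotRect]
  exact finite_rotRect _ _ _ _

lemma ncard_bdry_stdBox_le (α β : ℕ) : (bdry (stdBox α β)).ncard ≤ α + β + 4 := by
  rw [stdBox_eq_rotRect]
  exact (ncard_bdry_rotRect_le _ _ _ _).trans (by omega)

lemma two_mul_ncard_stdBox (α β : ℕ) : 2 * ((stdBox α β).ncard : ℤ) =
    (α + 1) * (β + 1) + if Even α ∧ Even β then 1 else 0 := by
  rw [stdBox_eq_rotRect, ncard_rotRect, two_mul_card_latticeRect]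
  by_cases h1 : Even α <;> by_cases h2 : Even β <;> simp [Nat.even_add_one, h1, h2]

lemma stdBox_size_bound {α β : ℕ} (h : β = α ∨ β = α + 1 ∨ Even α ∧ β = α + 2) :
    ((α : ℤ) + β + 2) ^ 2 - 1 ≤ 8 * ((stdBox α β).ncard : ℤ) := by
  have h2 := two_mul_ncard_stdBox α β
  rcases h with rfl | rfl | ⟨he, rfl⟩
  · split_ifs at h2 <;> nlinarith
  · push_cast at h2 ⊢
    split_ifs at h2 <;> nlinarith
  · rw [if_pos ⟨he, he.add (by decide)⟩] at h2
    push_cast at h2 ⊢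
    nlinarith

lemma nearlyExtremal_stdBox {α β : ℕ} (h : β = α ∨ β = α + 1 ∨ Even α ∧ β = α + 2) :
    NearlyExtremal (stdBox α β) := by
  refine ⟨finite_stdBox α β, le_trans ?_ (stdBox_size_bound h)⟩
  have h1 := ncard_bdry_stdBox_le α β
  have h2 := (isoperimetric (finite_stdBox α β) (stdBox_nonempty α β)).1
  have : (((bdry (stdBox α β)).ncard : ℤ) - 2) ^ 2 ≤ ((α : ℤ) + β + 2) ^ 2 :=
    pow_le_pow_left₀ (by omega) (by omega) 2
  linarith

/-- A smaller boundary would violate the isoperimetric inequality once α + β ≥ 2. The exception B(0,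
1) is a single point, with boundary 4 rather than 5. -/
lemma ncard_bdry_stdBox {α β : ℕ} (h : β = α ∨ β = α + 1) (h5 : α + β ≠ 1) :
    (bdry (stdBox α β)).ncard = α + β + 4 := by
  have h1 := ncard_bdry_stdBox_le α β
  obtain ⟨h2, h3⟩ := isoperimetric (finite_stdBox α β) (stdBox_nonempty α β)
  have h4 := stdBox_size_bound (h.imp_right Or.inl)
  by_contra hne
  have h6 : 2 ≤ α + β := by omega
  have : (((bdry (stdBox α β)).ncard : ℤ) - 2) ^ 2 ≤ ((α : ℤ) + β + 1) ^ 2 :=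
    pow_le_pow_left₀ (by omega) (by omega) 2
  zify at h6
  nlinarith

lemma IsExtremalBox.nearlyExtremal {A : Set (ℤ × ℤ)} (hA : IsExtremalBox A) :
    NearlyExtremal A := by
  obtain ⟨n, h | h | h⟩ := hA
  · exact h.nearlyExtremal (nearlyExtremal_stdBox (Or.inl rfl))
  · exact h.nearlyExtremal (nearlyExtremal_stdBox (Or.inr (Or.inl rfl)))
  · exact h.nearlyExtremal (nearlyExtremal_stdBox (Or.inr (Or.inr ⟨even_two_mul n, rfl⟩)))

/-! ### Efficient sets -/

lemma NearlyExtremal.isEfficient {A : Set (ℤ × ℤ)} (hA : NearlyExtremal A) : IsEfficient A := by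
  obtain ⟨hfin, hext⟩ := hA
  refine ⟨hfin, fun B hB hbd => ?_⟩
  rcases B.eq_empty_or_nonempty with rfl | hne
  · simp
  have h := (isoperimetric hB hne).2
  have hn : (bdry B).ncard = (bdry A).ncard := by rw [Set.ncard, hbd, Set.ncard]
  rw [hn] at h
  rw [← hB.cast_ncard_eq, ← hfin.cast_ncard_eq, Nat.cast_le]
  omega

lemma IsEfficient.nearlyExtremal {A : Set (ℤ × ℤ)} (hA : IsEfficient A) (hne : A.Nonempty) :
    NearlyExtremal A := by
  obtain ⟨hfin, hmax⟩ := hA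
  refine ⟨hfin, ?_⟩
  have h4 := (isoperimetric hfin hne).1
  have hpos := (Set.ncard_pos hfin).2 hne
  -- No comparison box has boundary 5, but there the bound only asks for |A| ≥ 1.
  by_cases h5 : (bdry A).ncard = 5
  · rw [h5]
    push_cast
    omega
  obtain ⟨α, β, hαβ, hn⟩ : ∃ α β : ℕ, (β = α ∨ β = α + 1) ∧ α + β + 4 = (bdry A).ncard :=
    ⟨((bdry A).ncard - 4) / 2, (bdry A).ncard - 4 - ((bdry A).ncard - 4) / 2, by omega, by omega⟩
  have hbd := ncard_bdry_stdBox hαβ (by omega)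
  have hle := hmax (stdBox α β) (finite_stdBox α β) (by
    rw [← (finite_bdry (finite_stdBox α β)).cast_ncard_eq, ← (finite_bdry hfin).cast_ncard_eq,
      hbd, hn])
  rw [← (finite_stdBox α β).cast_ncard_eq, ← hfin.cast_ncard_eq, Nat.cast_le] at hle
  have hs := stdBox_size_bound (hαβ.imp_right Or.inl)
  rw [← hn]
  push_cast
  have e : (α : ℤ) + β + 4 - 2 = α + β + 2 := by ring
  rw [e]
  omega

lemma NearlyExtremal.isSaturated {A : Set (ℤ × ℤ)} (hA : NearlyExtremal A)
    (hne : A.Nonempty) : IsSaturated A := by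
  obtain ⟨hfin, hext⟩ := hA
  intro v hv
  have hfin' : (A ∪ {v}).Finite := hfin.union (Set.finite_singleton v)
  rw [← (finite_bdry hfin).cast_ncard_eq, ← (finite_bdry hfin').cast_ncard_eq, Nat.cast_lt]
  -- Otherwise 8(|A| + 1) ≤ (n - 2)² + 4, whereas near extremality makes it at least (n - 2)² + 7.
  by_contra! hle
  obtain ⟨h1, h2⟩ := isoperimetric hfin' (hne.mono Set.subset_union_left)
  have h3 : (A ∪ {v}).ncard = A.ncard + 1 := by
    rw [Set.union_singleton, Set.ncard_insert_of_notMem hv hfin]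
  rw [h3] at h2
  have : (((bdry (A ∪ {v})).ncard : ℤ) - 2) ^ 2 ≤ (((bdry A).ncard : ℤ) - 2) ^ 2 :=
    pow_le_pow_left₀ (by omega) (by omega) 2
  push_cast at h2
  linarith

lemma ncard_bdry_singleton_le (v : ℤ × ℤ) : (bdry {v}).ncard ≤ 4 := by
  have h : ({v} : Set (ℤ × ℤ)) = rotRect (v.2 - v.1) (v.2 + v.1) 1 1 := by
    ext p
    simp only [rotRect, Set.mem_singleton_iff, Set.mem_ofPred_eq, Prod.ext_iff]
    push_cast
    omega
  rw [h]
  exact ncard_bdry_rotRect_le _ _ 1 1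

lemma NearlyExtremal.isMinimalSet {A : Set (ℤ × ℤ)} (hA : NearlyExtremal A)
    (hne : A.Nonempty) : IsMinimalSet A := by
  obtain ⟨hfin, hext⟩ := hA
  refine ⟨hfin, fun B hB => ?_⟩
  have hfinB : B.Finite := Set.encard_lt_top_iff.1 (hB ▸ hfin.encard_lt_top)
  have hneB : B.Nonempty := by
    rw [← Set.encard_pos, hB]
    exact Set.encard_pos.2 hne
  have hcard : B.ncard = A.ncard := by rw [Set.ncard, hB, Set.ncard]
  rw [← (finite_bdry hfin).cast_ncard_eq, ← (finite_bdry hfinB).cast_ncard_eq, Nat.cast_le]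
  obtain ⟨h1, h2⟩ := isoperimetric hfinB hneB
  by_contra! hlt
  -- A smaller boundary for the same size would give (n - 2)² - 1 ≤ (n - 3)² + 4, so n ≤ 5; hence 5
  -- is treated apart, where A would have to be a single point.
  by_cases h5 : (bdry A).ncard = 5
  · have h4 : (bdry B).ncard = 4 := by omega
    rw [h4, hcard] at h2
    have hpos := (Set.ncard_pos hfin).2 hne
    obtain ⟨v, rfl⟩ := Set.ncard_eq_one.1 (by omega : A.ncard = 1)
    have := ncard_bdry_singleton_le v
    omega
  · have : (((bdry B).ncard : ℤ) - 2) ^ 2 ≤ (((bdry A).ncard : ℤ) - 3) ^ 2 :=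
      pow_le_pow_left₀ (by omega) (by omega) 2
    rw [hcard] at h2
    have h7 : (6 : ℤ) ≤ (bdry A).ncard := by omega
    nlinarith

lemma IsExtremalBox.isBox {A : Set (ℤ × ℤ)} (hA : IsExtremalBox A) (hne : A.Nonempty) :
    IsBox A := by
  obtain ⟨n, h | h | h⟩ := hA <;> exact ⟨hne, Or.inl ⟨_, _, h⟩⟩

end LatticeIso

theorem theoremD (A : Set (ℤ × ℤ)) (hA : A.Nonempty) :
    (LatticeIso.IsEfficient A ↔
      ∃ n : ℕ, LatticeIso.Congruent A (LatticeIso.stdBox n n) ∨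
        LatticeIso.Congruent A (LatticeIso.stdBox n (n + 1)) ∨
        LatticeIso.Congruent A (LatticeIso.stdBox (2 * n) (2 * n + 2))) ∧
    (LatticeIso.IsEfficient A →
      LatticeIso.IsMinimalSet A ∧ LatticeIso.IsSaturated A ∧ LatticeIso.IsBox A) :=
  ⟨⟨fun h => (h.nearlyExtremal hA).isExtremalBox hA,
    fun h => (LatticeIso.IsExtremalBox.nearlyExtremal h).isEfficient⟩,
    fun h => ⟨(h.nearlyExtremal hA).isMinimalSet hA, (h.nearlyExtremal hA).isSaturated hA,
      ((h.nearlyExtremal hA).isExtremalBox hA).isBox hA⟩⟩
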